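/- For $(x,y,z)\in\mathbb Z^3$ the basic cube $(x,y,z)+[0,1]^3$ is called black if $x+y+z$ is odd and white if $x+y+z$ is even. A domino is the union of two basic cubes that share a face, and a tiling of a box $[0,L]\times[0,M]\times[0,N]$ is a covering of the box by dominoes, contained in it, with pairwise disjoint interiors. For a domino $d$, let $v(d)\in\{\pm e_x,\pm e_y,\pm e_z\}$ be the centre of its black cube minus the centre of its white cube. For $X\subset\mathbb R^3$ let $\mathcal S(X)$ be the interior of $(X+[0,\infty)e_z)\setminus X$. For dominoes $d_0,d_1$ put $$\tau(d_0,d_1)=\begin{cases}\tfrac14\det\bigl(v(d_1),v(d_0),e_z\bigr) & \text{if } d_1\cap\mathcal S(d_0)\neq\emptyset,\\ 0&\text{otherwise,}\end{cases}$$ and define the twist of a tiling $t$ of a box by $\mathrm{Tw}(t)=\sum_{d_0,d_1\in t}\tau(d_0,d_1)$. Let $\mathrm{maxtw}(L,M,N)$ be the maximum of $\mathrm{Tw}(t)$ over all tilings $t$ of $[0,L]\times[0,M]\times[0,N]$. Then $$\lim_{L,M\to\infty}\frac{\mathrm{maxtw}(L,M,2)}{4LM}=\frac1{16},$$ where $L$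 and $M$ are integers that tend to infinity independently (boxes with two floors always have a tiling, so the maximum exists). -/

import Mathlib

namespace DominoTwist

/-- A basic cube of `ℝ³`, given by its corner `(x, y, z) ∈ ℤ³` with the least coordinates. -/
abbrev Cell : Type := Fin 3 → ℤ

/-- The closed unit cube `(x, y, z) + [0,1]³`. -/
def cube (c : Cell) : Set (Fin 3 → ℝ) :=
  {p | ∀ i, (c i : ℝ) ≤ p i ∧ p i ≤ c i + 1}

/-- The subset of `ℝ³` formed by a finite family of basic cubes. -/
def solid (s : Finset Cell) : Set (Fin 3 → ℝ) :=
  ⋃ c ∈ s, cube c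

/-- The colour of a basic cube: `1` if it is black (`x + y + z` odd), `-1` if it is white
(`x + y + z` even). -/
def color (c : Cell) : ℤ :=
  if Odd (c 0 + c 1 + c 2) then 1 else -1

/-- A domino: two basic cubes that share a face. -/
def IsDomino (d : Finset Cell) : Prop :=
  ∃ (c : Cell) (i : Fin 3), d = {c, c + Pi.single i 1}

/-- `t` is a tiling of the region formed by the basic cubes in `R`: a covering of that region by
dominoes, no two of which have a basic cube in common. -/
def IsTiling (t : Finset (Finset Cell)) (R : Finset Cell) : Prop :=
  (∀ d ∈ t, IsDomino d) ∧ (t : Set (Finset Cell)).PairwiseDisjoint id ∧ t.biUnion id = R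

/-- For a domino, this is the centre of its black cube minus the centre of its white cube. -/
def dominoVec (d : Finset Cell) : Fin 3 → ℤ :=
  ∑ c ∈ d, color c • c

/-- The open shade of `X` in direction `u`: the interior of `(X + [0,∞) u) \ X`. -/
def shade (u : Fin 3 → ℤ) (X : Set (Fin 3 → ℝ)) : Set (Fin 3 → ℝ) :=
  interior ({p | ∃ x ∈ X, ∃ s : ℝ, 0 ≤ s ∧ p = x + s • fun i => (u i : ℝ)} \ X)

open Classical in
/-- The effect of `d₀` on `d₁` along `u`. -/
noncomputable def effect (u : Fin 3 → ℤ) (d₀ d₁ : Finset Cell) : ℝ :=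
  if (solid d₁ ∩ shade u (solid d₀)).Nonempty then
    1 / 4 * ((Matrix.of ![dominoVec d₁, dominoVec d₀, u]).det : ℝ)
  else 0

/-- The pretwist of `t` along `u`. -/
noncomputable def pretwist (u : Fin 3 → ℤ) (t : Finset (Finset Cell)) : ℝ :=
  ∑ d₀ ∈ t, ∑ d₁ ∈ t, effect u d₀ d₁

/-- The twist of a tiling of a box, as the pretwist along the third axis. -/
noncomputable def twist (t : Finset (Finset Cell)) : ℝ :=
  pretwist ![0, 0, 1] t

/-- The basic cubes of the box `[0,L] × [0,M] × [0,N]`. -/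
noncomputable def box (L M N : ℕ) : Finset Cell :=
  Fintype.piFinset ![Finset.Ico 0 (L : ℤ), Finset.Ico 0 (M : ℤ), Finset.Ico 0 (N : ℤ)]

/-- The set of twists of tilings of a region. -/
def twistValues (R : Finset Cell) : Set ℝ :=
  {a | ∃ t, IsTiling t R ∧ twist t = a}

/-- The largest twist of a tiling of the box `[0,L] × [0,M] × [0,N]`. -/
noncomputable def maxTwist (L M N : ℕ) : ℝ :=
  sSup (twistValues (box L M N))

theorem finite_twistValues (R : Finset Cell) : (twistValues R).Finite := by
  have h : {t : Finset (Finset Cell) | IsTiling t R}.Finite := by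
    refine (R.powerset.powerset.finite_toSet).subset fun t ht => ?_
    simp only [Finset.coe_powerset, Set.mem_preimage, Set.mem_powerset_iff]
    intro d hd
    have : d ⊆ t.biUnion id := Finset.subset_biUnion_of_mem id (by simpa using hd)
    rw [ht.2.2] at this
    simpa using this
  refine (h.image twist).subset ?_
  rintro a ⟨t, ht, rfl⟩
  exact ⟨t, ht, rfl⟩

theorem exists_isTiling_box_two (L M : ℕ) : ∃ t, IsTiling t (box L M 2) := by
  let D : Cell → Finset Cell := fun c => {c, c + Pi.single 2 1}
  refine ⟨(box L M 1).image D, ?_, ?_, ?_⟩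
  · intro d hd
    obtain ⟨c, -, rfl⟩ := Finset.mem_image.1 hd
    exact ⟨c, 2, rfl⟩
  · intro d hd e he hne
    simp only [Finset.coe_image, Set.mem_image, Finset.mem_coe] at hd he
    obtain ⟨c, hc, rfl⟩ := hd
    obtain ⟨c', hc', rfl⟩ := he
    simp only [Function.onFun, id, Finset.disjoint_left]
    intro a ha ha'
    apply hne
    have : c = c' := by
      simp [box, Fin.forall_fin_succ] at hc hc'
      simp only [D, Finset.mem_insert, Finset.mem_singleton] at ha ha'
      funext i
      rcases ha with rfl | rfl <;> rcases ha' with h | h <;>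
        (have h0 := congrFun h 0; have h1 := congrFun h 1; have h2 := congrFun h 2
         fin_cases i <;> simp_all <;> omega)
    rw [this]
  · ext a
    simp only [Finset.mem_biUnion, Finset.mem_image, id, D]
    constructor
    · rintro ⟨d, ⟨c, hc, rfl⟩, ha⟩
      simp [box, Fin.forall_fin_succ] at hc ⊢
      simp only [Finset.mem_insert, Finset.mem_singleton] at ha
      rcases ha with rfl | rfl <;> simp_all <;> omega
    · intro ha
      simp [box, Fin.forall_fin_succ] at ha
      by_cases h : a 2 = 0
      · refine ⟨_, ⟨a, ?_, rfl⟩, by simp⟩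
        simp [box, Fin.forall_fin_succ]; omega
      · refine ⟨_, ⟨a - Pi.single 2 1, ?_, rfl⟩, by simp⟩
        simp [box, Fin.forall_fin_succ, Pi.single_apply]; omega

/-- For two floors the maximum that defines `maxTwist` is attained. -/
theorem isGreatest_maxTwist_two (L M : ℕ) :
    IsGreatest (twistValues (box L M 2)) (maxTwist L M 2) := by
  obtain ⟨t, ht⟩ := exists_isTiling_box_two L M
  have hne : (twistValues (box L M 2)).Nonempty := ⟨_, t, ht, rfl⟩
  have hf := finite_twistValues (box L M 2)
  exact ⟨hne.csSup_mem hf, fun a ha => le_csSup hf.bddAbove ha⟩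

/-- The shade along the third axis, read off from the basic cubes: `d₁` meets the open shade of
`d₀` exactly if some basic cube of `d₁`, not in `d₀`, lies above a basic cube of `d₀`. -/
theorem solid_inter_shade_nonempty_iff (d₀ d₁ : Finset Cell) :
    (solid d₁ ∩ shade ![0, 0, 1] (solid d₀)).Nonempty ↔
      ∃ c₁ ∈ d₁, c₁ ∉ d₀ ∧ ∃ c₀ ∈ d₀, c₀ 0 = c₁ 0 ∧ c₀ 1 = c₁ 1 ∧ c₀ 2 ≤ c₁ 2 := by
  constructor
  · rintro ⟨p, hp, hps⟩
    simp only [solid, Set.mem_iUnion] at hp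
    obtain ⟨c₁, hc₁, hp⟩ := hp
    obtain ⟨ε, hε, hball⟩ := Metric.isOpen_iff.1 isOpen_interior p hps
    -- move `p` slightly towards the centre of its cube
    obtain ⟨δ, hδ0, hδ⟩ : ∃ δ : ℝ, 0 < δ ∧ δ < min ε 1 := exists_between (lt_min hε one_pos)
    have hδε := hδ.trans_le (min_le_left _ _)
    have hδ1 := hδ.trans_le (min_le_right _ _)
    let q : Fin 3 → ℝ := fun i => p i + δ * (c₁ i + 1 / 2 - p i)
    have hq : ∀ i, (c₁ i : ℝ) < q i ∧ q i < c₁ i + 1 := by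
      intro i
      obtain ⟨h1, h2⟩ := hp i
      simp only [q]
      constructor <;> nlinarith
    have hqs := interior_subset (hball (show q ∈ Metric.ball p ε by
      rw [Metric.mem_ball, dist_pi_lt_iff hε]
      intro i
      obtain ⟨h1, h2⟩ := hp i
      rw [Real.dist_eq, abs_lt]
      simp only [q]
      constructor <;> nlinarith))
    obtain ⟨⟨x, hx, s, hs, hqx⟩, hqn⟩ := hqs
    refine ⟨c₁, hc₁, fun h => hqn ?_, ?_⟩
    · simp only [solid, Set.mem_iUnion]
      exact ⟨c₁, h, fun i => ⟨(hq i).1.le, (hq i).2.le⟩⟩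
    · simp only [solid, Set.mem_iUnion] at hx
      obtain ⟨c₀, hc₀, hx⟩ := hx
      have q0 := hq 0
      have q1 := hq 1
      have q2 := hq 2
      have x0 := hx 0
      have x1 := hx 1
      have x2 := hx 2
      rw [hqx] at q0 q1 q2
      simp at q0 q1 q2
      have a1 : c₀ 0 < c₁ 0 + 1 := by
        have : (c₀ 0 : ℝ) < c₁ 0 + 1 := by linarith
        exact_mod_cast this
      have a2 : c₁ 0 < c₀ 0 + 1 := by
        have : (c₁ 0 : ℝ) < c₀ 0 + 1 := by linarith
        exact_mod_cast this
      have a3 : c₀ 1 < c₁ 1 + 1 := by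
        have : (c₀ 1 : ℝ) < c₁ 1 + 1 := by linarith
        exact_mod_cast this
      have a4 : c₁ 1 < c₀ 1 + 1 := by
        have : (c₁ 1 : ℝ) < c₀ 1 + 1 := by linarith
        exact_mod_cast this
      have a5 : c₀ 2 < c₁ 2 + 1 := by
        have : (c₀ 2 : ℝ) < c₁ 2 + 1 := by linarith
        exact_mod_cast this
      exact ⟨c₀, hc₀, by omega, by omega, by omega⟩
  · rintro ⟨c₁, hc₁, hn, c₀, hc₀, h0, h1, h2⟩
    let U : Set (Fin 3 → ℝ) := Set.univ.pi fun i => Set.Ioo (c₁ i : ℝ) (c₁ i + 1)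
    have hU : IsOpen U := isOpen_set_pi Set.finite_univ fun i _ => isOpen_Ioo
    refine ⟨fun i => c₁ i + 1 / 2, ?_, interior_maximal ?_ hU (?_ : _ ∈ U)⟩
    · simp only [solid, Set.mem_iUnion]
      exact ⟨c₁, hc₁, fun i => ⟨by linarith, by linarith⟩⟩
    · intro p hp
      have hp : ∀ i, (c₁ i : ℝ) < p i ∧ p i < c₁ i + 1 := fun i => hp i trivial
      refine ⟨⟨fun i => p i - (c₁ i - c₀ i), ?_, (c₁ 2 - c₀ 2 : ℝ), ?_, ?_⟩, ?_⟩
      · simp only [solid, Set.mem_iUnion]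
        refine ⟨c₀, hc₀, fun i => ?_⟩
        have := hp i
        constructor <;> dsimp only <;> linarith
      · have : (c₀ 2 : ℝ) ≤ c₁ 2 := by exact_mod_cast h2
        linarith
      · funext i
        fin_cases i <;> simp [h0, h1]
      · simp only [solid, Set.mem_iUnion, not_exists]
        intro c hc hpc
        apply hn
        have : c = c₁ := by
          funext i
          have b := hp i
          have b' := hpc i
          have e1 : c i < c₁ i + 1 := by
            have : (c i : ℝ) < c₁ i + 1 := by linarith
            exact_mod_cast this
          have e2 : c₁ i < c i + 1 := by
            have : (c₁ i : ℝ) < c i + 1 := by linarith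
            exact_mod_cast this
          omega
        rwa [← this]
    · intro i _
      constructor <;> dsimp only <;> linarith

end DominoTwist

namespace DominoTwist

/-! With two floors, `d₁` meets the shade of `d₀` only if some column has `d₀` below and a different
domino `d₁` above. Each column determines one such pair at most, and the determinant of signed unit
vectors is at most 1, so the twist is at most `L * M / 4` (`IsTiling.twist_le`).

This bound is asymptotically sharp. In a diamond `|x| + |y| < s` with `s` even, the columns with
`|x| + |y| ∈ {2k, 2k + 1}`, tips removed, form a closed staircase. A cycle of even length has two
perfect matchings; one is used on each floor. Off the axes the staircase turns at every column, so
the dominoes there cross at a right angle, always with the same sign, and contribute 1/4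
(`InRing.det_ringStep`). On the axes they contribute 0, as do vertical dominoes, which fill the
rest. Diamonds of radius `s` tile the plane up to their boundaries, so a fixed large `s` gives a
twist near `L * M / 4` in large boxes (`le_maxTwist_of_le`). -/

theorem mem_box_two {L M : ℕ} {c : Cell} :
    c ∈ box L M 2 ↔ (0 ≤ c 0 ∧ c 0 < L) ∧ (0 ≤ c 1 ∧ c 1 < M) ∧ (c 2 = 0 ∨ c 2 = 1) := by
  simp [box, Fin.forall_fin_succ]
  omega

/-! ### Columns and the pairs of dominoes over them. -/

/-- The columns of a box, given by the first two coordinates of their cubes. -/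
noncomputable def columns (L M : ℕ) : Finset (ℤ × ℤ) := Finset.Ico 0 (L : ℤ) ×ˢ Finset.Ico 0 (M : ℤ)

theorem mem_columns {L M : ℕ} {c : ℤ × ℤ} :
    c ∈ columns L M ↔ (0 ≤ c.1 ∧ c.1 < L) ∧ (0 ≤ c.2 ∧ c.2 < M) := by
  simp [columns]

theorem card_columns (L M : ℕ) : (columns L M).card = L * M := by
  simp [columns]

theorem cell_eta (c : Cell) : ![c 0, c 1, c 2] = c := by
  funext i; fin_cases i <;> rfl

theorem IsTiling.eq_of_mem {t : Finset (Finset Cell)} {R : Finset Cell} (ht : IsTiling t R)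
    {d e : Finset Cell} (hd : d ∈ t) (he : e ∈ t) {c : Cell} (hcd : c ∈ d) (hce : c ∈ e) :
    d = e := by
  by_contra h
  exact Finset.disjoint_left.1 (ht.2.1 hd he h) hcd hce

theorem IsTiling.mem_region {t : Finset (Finset Cell)} {R : Finset Cell} (ht : IsTiling t R)
    {d : Finset Cell} (hd : d ∈ t) {c : Cell} (hc : c ∈ d) : c ∈ R := by
  rw [← ht.2.2]
  exact Finset.mem_biUnion.2 ⟨d, hd, hc⟩

theorem IsTiling.sum_ite_mem {t : Finset (Finset Cell)} {R : Finset Cell} (ht : IsTiling t R)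
    {c : Cell} (hc : c ∈ R) (a : ℝ) : ∑ d ∈ t, (if c ∈ d then a else 0) = a := by
  rw [← ht.2.2] at hc
  obtain ⟨d, hd, hcd⟩ := Finset.mem_biUnion.1 hc
  rw [Finset.sum_eq_single d]
  · exact if_pos hcd
  · intro e he hne
    exact if_neg fun h => hne (ht.eq_of_mem he hd h hcd)
  · exact fun h => absurd hd h

/-- A weight on the columns, seen as an interaction of the dominoes on the two floors. -/
noncomputable def interaction (L M : ℕ) (w : ℤ × ℤ → ℝ) (d₀ d₁ : Finset Cell) : ℝ :=
  ∑ c ∈ columns L M, if ![c.1, c.2, 0] ∈ d₀ ∧ ![c.1, c.2, 1] ∈ d₁ then w c else 0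

/-- Each column has exactly one domino on each floor. The upper bound uses the weight 1/4, the
construction the weight `columnTwist`. -/
theorem IsTiling.sum_interaction {t : Finset (Finset Cell)} {L M : ℕ}
    (ht : IsTiling t (box L M 2)) (w : ℤ × ℤ → ℝ) :
    ∑ d₀ ∈ t, ∑ d₁ ∈ t, interaction L M w d₀ d₁ = ∑ c ∈ columns L M, w c := by
  simp only [interaction]
  rw [Finset.sum_congr rfl fun d₀ _ => Finset.sum_comm, Finset.sum_comm]
  refine Finset.sum_congr rfl fun c hc => ?_
  rw [mem_columns] at hc
  have h0 : (![c.1, c.2, 0] : Cell) ∈ box L M 2 := by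
    rw [mem_box_two]; simpa using hc
  have h1 : (![c.1, c.2, 1] : Cell) ∈ box L M 2 := by
    rw [mem_box_two]; simpa using hc
  calc _ = ∑ d₀ ∈ t, if ![c.1, c.2, 0] ∈ d₀ then
          ∑ d₁ ∈ t, (if ![c.1, c.2, 1] ∈ d₁ then w c else 0) else 0 := by
        refine Finset.sum_congr rfl fun d₀ _ => ?_
        split_ifs with h <;> simp [h]
    _ = w c := by rw [ht.sum_ite_mem h1, ht.sum_ite_mem h0]

/-- In a tiling of a box with two floors, `d₁` meets the shade of a different domino `d₀` exactly
if they have a column in common, `d₀` on the lower and `d₁` on the upper floor. -/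
theorem IsTiling.exists_column {t : Finset (Finset Cell)} {L M : ℕ}
    (ht : IsTiling t (box L M 2)) {d₀ d₁ : Finset Cell} (h₀ : d₀ ∈ t) (h₁ : d₁ ∈ t)
    (h : (solid d₁ ∩ shade ![0, 0, 1] (solid d₀)).Nonempty) :
    ∃ c ∈ columns L M, ![c.1, c.2, 0] ∈ d₀ ∧ ![c.1, c.2, 1] ∈ d₁ := by
  obtain ⟨c₁, hc₁, hn, c₀, hc₀, e0, e1, e2⟩ := (solid_inter_shade_nonempty_iff d₀ d₁).1 h
  have b0 := mem_box_two.1 (ht.mem_region h₀ hc₀)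
  have b1 := mem_box_two.1 (ht.mem_region h₁ hc₁)
  have hne : c₀ 2 ≠ c₁ 2 := by
    intro e
    apply hn
    rwa [← cell_eta c₁, ← e0, ← e1, ← e, cell_eta]
  refine ⟨(c₁ 0, c₁ 1), mem_columns.2 ⟨b1.1, b1.2.1⟩, ?_, ?_⟩
  · have : (0 : ℤ) = c₀ 2 := by omega
    rw [this, ← e0, ← e1]; dsimp only; rwa [cell_eta]
  · have : (1 : ℤ) = c₁ 2 := by omega
    rw [this]; dsimp only; rwa [cell_eta]

/-! ### Vectors of dominoes and the upper bound. -/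

theorem color_mul_self (c : Cell) : color c * color c = 1 := by
  unfold color; split_ifs <;> rfl

theorem color_add {c δ : Cell} (hδ : Odd (δ 0 + δ 1 + δ 2)) : color (c + δ) = -color c := by
  have : Odd ((c + δ) 0 + (c + δ) 1 + (c + δ) 2) ↔ ¬ Odd (c 0 + c 1 + c 2) := by
    simp only [Pi.add_apply, Int.odd_iff] at hδ ⊢
    omega
  unfold color
  simp only [this]
  split_ifs <;> simp

theorem dominoVec_pair {c δ : Cell} (hδ : Odd (δ 0 + δ 1 + δ 2)) :
    dominoVec {c, c + δ} = -color c • δ := by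
  have hne : c ≠ c + δ := by
    intro h
    have h0 := congrFun h 0
    have h1 := congrFun h 1
    have h2 := congrFun h 2
    simp only [Pi.add_apply, Int.odd_iff] at h0 h1 h2 hδ
    omega
  rw [dominoVec, Finset.sum_pair hne, color_add hδ]
  module

theorem effect_le (d₀ d₁ : Finset Cell) (h₀ : IsDomino d₀) (h₁ : IsDomino d₁) :
    effect ![0, 0, 1] d₀ d₁ ≤ 1 / 4 := by
  unfold effect
  split_ifs
  · obtain ⟨c, i, rfl⟩ := h₀
    obtain ⟨c', j, rfl⟩ := h₁
    have hodd : ∀ i : Fin 3, Odd ((Pi.single i 1 : Cell) 0 + (Pi.single i 1 : Cell) 1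
        + (Pi.single i 1 : Cell) 2) := by
      intro i; fin_cases i <;> simp
    rw [dominoVec_pair (hodd i), dominoVec_pair (hodd j)]
    have key : (Matrix.of ![-color c' • (Pi.single j 1 : Cell), -color c • (Pi.single i 1 : Cell),
        ![0, 0, 1]]).det ≤ 1 := by
      have e : color c = 1 ∨ color c = -1 := by unfold color; split_ifs <;> simp
      have e' : color c' = 1 ∨ color c' = -1 := by unfold color; split_ifs <;> simp
      rw [Matrix.det_fin_three]
      rcases e with e | e <;> rcases e' with e' | e' <;> rw [e, e'] <;>
        fin_cases i <;> fin_cases j <;> simp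
    have : (((Matrix.of ![-color c' • (Pi.single j 1 : Cell), -color c • (Pi.single i 1 : Cell),
        ![0, 0, 1]]).det : ℤ) : ℝ) ≤ 1 := by exact_mod_cast key
    linarith
  · norm_num

theorem IsTiling.twist_le {t : Finset (Finset Cell)} {L M : ℕ} (ht : IsTiling t (box L M 2)) :
    twist t ≤ L * M / 4 := by
  have h : twist t ≤ ∑ d₀ ∈ t, ∑ d₁ ∈ t, interaction L M (fun _ => 1 / 4) d₀ d₁ := by
    refine Finset.sum_le_sum fun d₀ h₀ => Finset.sum_le_sum fun d₁ h₁ => ?_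
    have hnn : ∀ c ∈ columns L M,
        (0 : ℝ) ≤ if ![c.1, c.2, 0] ∈ d₀ ∧ ![c.1, c.2, 1] ∈ d₁ then 1 / 4 else 0 := by
      intro c _
      split_ifs <;> norm_num
    by_cases hs : (solid d₁ ∩ shade ![0, 0, 1] (solid d₀)).Nonempty
    · obtain ⟨c, hc, hcd⟩ := ht.exists_column h₀ h₁ hs
      refine (effect_le d₀ d₁ (ht.1 _ h₀) (ht.1 _ h₁)).trans ?_
      have := Finset.single_le_sum hnn hc
      rwa [if_pos hcd] at this
    · rw [effect, if_neg hs]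
      exact Finset.sum_nonneg hnn
  rw [ht.sum_interaction, Finset.sum_const, card_columns] at h
  simp only [nsmul_eq_mul] at h
  push_cast at h
  linarith

/-! ### Tilings given by displacements, and their twist. -/

/-- The dominoes are the orbits of an involution that moves every cube to a neighbour. -/
theorem isTiling_image_pair {R : Finset Cell} {g : Cell → Cell} (hR : ∀ c ∈ R, g c ∈ R)
    (hg : ∀ c ∈ R, g (g c) = c)
    (hadj : ∀ c ∈ R, ∃ i : Fin 3, g c = c + Pi.single i 1 ∨ c = g c + Pi.single i 1) :
    IsTiling (R.image fun c => {c, g c}) R := by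
  refine ⟨?_, ?_, ?_⟩
  · intro d hd
    obtain ⟨c, hc, rfl⟩ := Finset.mem_image.1 hd
    obtain ⟨i, h | h⟩ := hadj c hc
    · exact ⟨c, i, by rw [← h]⟩
    · exact ⟨g c, i, by rw [← h, Finset.pair_comm]⟩
  · intro d hd e he hne
    simp only [Finset.coe_image, Set.mem_image, Finset.mem_coe] at hd he
    obtain ⟨c, hc, rfl⟩ := hd
    obtain ⟨c', hc', rfl⟩ := he
    simp only [Function.onFun, id, Finset.disjoint_left]
    intro a ha ha'
    apply hne
    have key : ∀ b ∈ R, a ∈ ({b, g b} : Finset Cell) → ({b, g b} : Finset Cell) = {a, g a} := by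
      intro b hb hab
      simp only [Finset.mem_insert, Finset.mem_singleton] at hab
      rcases hab with rfl | rfl
      · rfl
      · rw [hg b hb, Finset.pair_comm]
    rw [key c hc ha, key c' hc' ha']
  · ext a
    simp only [Finset.mem_biUnion, Finset.mem_image, id]
    constructor
    · rintro ⟨d, ⟨c, hc, rfl⟩, ha⟩
      simp only [Finset.mem_insert, Finset.mem_singleton] at ha
      rcases ha with rfl | rfl
      · exact hc
      · exact hR c hc
    · exact fun ha => ⟨_, ⟨a, ha, rfl⟩, by simp⟩

/-- A description of a tiling of a box with two floors: the cube over column `(x, y)` on floor `z`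
forms a domino with the cube displaced by `D z x y`, or with the other cube of its column if this
displacement is zero. -/
structure IsDuplexPlan (L M : ℕ) (D : ℤ → ℤ → ℤ → ℤ × ℤ) : Prop where
  unit : ∀ z x y, D z x y = 0 ∨ D z x y = (1, 0) ∨ D z x y = (-1, 0) ∨ D z x y = (0, 1) ∨
    D z x y = (0, -1)
  mem : ∀ z x y, (x, y) ∈ columns L M → (x + (D z x y).1, y + (D z x y).2) ∈ columns L M
  symm : ∀ z x y, D z (x + (D z x y).1) (y + (D z x y).2) = -D z x y
  vertical : ∀ x y, D 0 x y = 0 ↔ D 1 x y = 0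

/-- The cube that forms a domino with a given one. -/
def partner (D : ℤ → ℤ → ℤ → ℤ × ℤ) (c : Cell) : Cell :=
  if D (c 2) (c 0) (c 1) = 0 then ![c 0, c 1, 1 - c 2]
  else ![c 0 + (D (c 2) (c 0) (c 1)).1, c 1 + (D (c 2) (c 0) (c 1)).2, c 2]

/-- The contribution of a column to the twist. -/
noncomputable def columnTwist (D : ℤ → ℤ → ℤ → ℤ × ℤ) (c : ℤ × ℤ) : ℝ :=
  1 / 4 * (((D 0 c.1 c.2).1 * (D 1 c.1 c.2).2 - (D 0 c.1 c.2).2 * (D 1 c.1 c.2).1 : ℤ) : ℝ)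

/-- The dominoes of a plan. -/
noncomputable def planTiling (L M : ℕ) (D : ℤ → ℤ → ℤ → ℤ × ℤ) : Finset (Finset Cell) :=
  (box L M 2).image fun c => {c, partner D c}

namespace IsDuplexPlan

variable {L M : ℕ} {D : ℤ → ℤ → ℤ → ℤ × ℤ}

theorem isTiling (h : IsDuplexPlan L M D) : IsTiling (planTiling L M D) (box L M 2) := by
  apply isTiling_image_pair
  · intro c hc
    rw [mem_box_two] at hc ⊢
    have := mem_columns.1 (h.mem (c 2) (c 0) (c 1) (mem_columns.2 ⟨hc.1, hc.2.1⟩))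
    unfold partner
    split_ifs
    · simp; omega
    · simp at this ⊢; omega
  · intro c hc
    rw [mem_box_two] at hc
    have hv := h.vertical (c 0) (c 1)
    by_cases h0 : D (c 2) (c 0) (c 1) = 0
    · have h1 : D (1 - c 2) (c 0) (c 1) = 0 := by
        rcases hc.2.2 with e | e <;> rw [e] at h0 ⊢ <;> simp <;> tauto
      have e : partner D c = ![c 0, c 1, 1 - c 2] := if_pos h0
      rw [e, show partner D ![c 0, c 1, 1 - c 2] = ![c 0, c 1, 1 - (1 - c 2)] from if_pos h1,
        sub_sub_cancel, cell_eta]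
    · have e : partner D c
          = ![c 0 + (D (c 2) (c 0) (c 1)).1, c 1 + (D (c 2) (c 0) (c 1)).2, c 2] := if_neg h0
      have e' := h.symm (c 2) (c 0) (c 1)
      have h1 : D (c 2) (c 0 + (D (c 2) (c 0) (c 1)).1) (c 1 + (D (c 2) (c 0) (c 1)).2) ≠ 0 := by
        rw [e']; simpa using h0
      rw [e]
      refine (if_neg h1).trans ?_
      rw [← cell_eta c]
      simp [e']
  · intro c hc
    rw [mem_box_two] at hc
    unfold partner
    split_ifs with h0
    · refine ⟨2, ?_⟩
      rcases hc.2.2 with e | e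
      · left; funext i; fin_cases i <;> simp [e]
      · right; funext i; fin_cases i <;> simp [e]
    · rcases h.unit (c 2) (c 0) (c 1) with e | e | e | e | e
      · exact absurd e h0
      · refine ⟨0, .inl ?_⟩; funext i; fin_cases i <;> simp [e]
      · refine ⟨0, .inr ?_⟩; funext i; fin_cases i <;> simp [e]
      · refine ⟨1, .inl ?_⟩; funext i; fin_cases i <;> simp [e]
      · refine ⟨1, .inr ?_⟩; funext i; fin_cases i <;> simp [e]

theorem eq_pair (h : IsDuplexPlan L M D) {d : Finset Cell} (hd : d ∈ planTiling L M D)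
    {c : Cell} (hc : c ∈ d) : d = {c, partner D c} :=
  h.isTiling.eq_of_mem hd (Finset.mem_image_of_mem _ (h.isTiling.mem_region hd hc)) hc (by simp)

/-- The two cubes of a column have opposite colours, so the colour signs in the two domino vectors
multiply to -1; this reverses the order of the rows in the determinant. A vertical domino is not in
its own shade. -/
theorem effect_eq_columnTwist (h : IsDuplexPlan L M D) {d₀ d₁ : Finset Cell}
    (h₀ : d₀ ∈ planTiling L M D) (h₁ : d₁ ∈ planTiling L M D) {c : ℤ × ℤ}
    (hc₀ : ![c.1, c.2, 0] ∈ d₀) (hc₁ : ![c.1, c.2, 1] ∈ d₁) :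
    effect ![0, 0, 1] d₀ d₁ = columnTwist D c := by
  have e₀ := h.eq_pair h₀ hc₀
  have e₁ := h.eq_pair h₁ hc₁
  by_cases hD : D 0 c.1 c.2 = 0
  · have hD' := (h.vertical _ _).1 hD
    have e : d₀ = d₁ := by
      rw [e₀, e₁]
      simp [partner, hD, hD', Finset.pair_comm]
    have hempty : ¬ (solid d₁ ∩ shade ![0, 0, 1] (solid d₀)).Nonempty := by
      rw [solid_inter_shade_nonempty_iff, e]
      tauto
    rw [effect, if_neg hempty]
    simp [columnTwist, hD]
  · have hD' := (h.vertical c.1 c.2).not.1 hD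
    have p₀ : partner D ![c.1, c.2, 0]
        = ![c.1, c.2, 0] + ![(D 0 c.1 c.2).1, (D 0 c.1 c.2).2, 0] := by
      simp [partner, hD]
    have p₁ : partner D ![c.1, c.2, 1]
        = ![c.1, c.2, 1] + ![(D 1 c.1 c.2).1, (D 1 c.1 c.2).2, 0] := by
      simp [partner, hD']
    have hs : (solid d₁ ∩ shade ![0, 0, 1] (solid d₀)).Nonempty := by
      rw [solid_inter_shade_nonempty_iff]
      refine ⟨_, hc₁, ?_, _, hc₀, by simp⟩
      rw [e₀, p₀]
      simp
    have o : ∀ z, D z c.1 c.2 ≠ 0 →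
        Odd ((![(D z c.1 c.2).1, (D z c.1 c.2).2, 0] : Cell) 0
          + (![(D z c.1 c.2).1, (D z c.1 c.2).2, 0] : Cell) 1
          + (![(D z c.1 c.2).1, (D z c.1 c.2).2, 0] : Cell) 2) := by
      intro z hz
      rcases h.unit z c.1 c.2 with e | e | e | e | e
      · exact absurd e hz
      all_goals simp [e]
    have hcol : color ![c.1, c.2, 1] = -color ![c.1, c.2, 0] := by
      rw [← color_add (c := ![c.1, c.2, 0]) (δ := ![0, 0, 1]) (by simp)]
      simp
    rw [effect, if_pos hs, e₀, e₁, p₀, p₁, dominoVec_pair (o 0 hD), dominoVec_pair (o 1 hD'),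
      columnTwist]
    congr 2
    rw [hcol, Matrix.det_fin_three]
    simp
    linear_combination ((D 0 c.1 c.2).1 * (D 1 c.1 c.2).2 - (D 0 c.1 c.2).2 * (D 1 c.1 c.2).1)
      * color_mul_self ![c.1, c.2, 0]

/-- Dominoes that share two columns lie exactly above each other, hence are parallel and have
determinant 0. So no nonzero column weight is counted together with another column of the same pair.
-/
theorem eq_of_columnTwist_ne_zero (h : IsDuplexPlan L M D) {d₀ d₁ : Finset Cell}
    (h₀ : d₀ ∈ planTiling L M D) (h₁ : d₁ ∈ planTiling L M D) {c c' : ℤ × ℤ}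
    (hc₀ : ![c.1, c.2, 0] ∈ d₀) (hc₁ : ![c.1, c.2, 1] ∈ d₁)
    (hc₀' : ![c'.1, c'.2, 0] ∈ d₀) (hc₁' : ![c'.1, c'.2, 1] ∈ d₁)
    (hw : columnTwist D c ≠ 0) : c' = c := by
  by_contra hne
  have hne' : ∀ z : ℤ, (![c'.1, c'.2, z] : Cell) ≠ ![c.1, c.2, z] := by
    intro z e
    have e0 := congrFun e 0
    have e1 := congrFun e 1
    simp at e0 e1
    exact hne (Prod.ext e0 e1)
  apply hw
  have hD : D 0 c.1 c.2 ≠ 0 := fun e => hw (by simp [columnTwist, e])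
  have hD' := (h.vertical c.1 c.2).not.1 hD
  rw [h.eq_pair h₀ hc₀, Finset.mem_insert, Finset.mem_singleton] at hc₀'
  rw [h.eq_pair h₁ hc₁, Finset.mem_insert, Finset.mem_singleton] at hc₁'
  have k₀ := hc₀'.resolve_left (hne' 0)
  have k₁ := hc₁'.resolve_left (hne' 1)
  simp [partner, hD] at k₀
  simp [partner, hD'] at k₁
  have a : (D 0 c.1 c.2).1 = (D 1 c.1 c.2).1 := by omega
  have b : (D 0 c.1 c.2).2 = (D 1 c.1 c.2).2 := by omega
  rw [columnTwist, a, b]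
  simp [mul_comm]

theorem twist_eq (h : IsDuplexPlan L M D) :
    twist (planTiling L M D) = ∑ c ∈ columns L M, columnTwist D c := by
  rw [← h.isTiling.sum_interaction]
  refine Finset.sum_congr rfl fun d₀ h₀ => Finset.sum_congr rfl fun d₁ h₁ => ?_
  by_cases hex : ∃ c ∈ columns L M, ![c.1, c.2, 0] ∈ d₀ ∧ ![c.1, c.2, 1] ∈ d₁
  · obtain ⟨c, hc, hc₀, hc₁⟩ := hex
    have heff := h.effect_eq_columnTwist h₀ h₁ hc₀ hc₁
    rw [interaction, Finset.sum_eq_single c]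
    · rw [if_pos ⟨hc₀, hc₁⟩, heff]
    · intro c' _ hne
      split_ifs with hcc
      · by_contra hw
        exact hne (h.eq_of_columnTwist_ne_zero h₀ h₁ hcc.1 hcc.2 hc₀ hc₁ hw).symm
      · rfl
    · exact fun hn => absurd hc hn
  · have hs : ¬ (solid d₁ ∩ shade ![0, 0, 1] (solid d₀)).Nonempty :=
      fun hs => hex (h.isTiling.exists_column h₀ h₁ hs)
    rw [effect, if_neg hs, interaction, Finset.sum_eq_zero]
    exact fun c hc => if_neg fun hcc => hex ⟨c, hc, hcc⟩

end IsDuplexPlan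

/-! ### Rings in a diamond. -/

/-- The columns of the diamond `|x| + |y| < s` that the rings `|x| + |y| ∈ {2k, 2k + 1}`, without
their tips, run through. -/
def InRing (s x y : ℤ) : Prop :=
  (x + y < s ∧ x - y < s ∧ -x + y < s ∧ -x - y < s) ∧
    ((x + y) % 2 = 0 → x ≠ 0 ∨ y ≠ 0) ∧ ((x + y) % 2 = 1 → x ≠ 0 ∧ y ≠ 0)

/-- The displacement along the rings around the origin, on floor `0` against the clock from the
odd columns, on the other floor with it. -/
def ringStep (z x y : ℤ) : ℤ × ℤ :=
  if z = 0 then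
    if (x + y) % 2 = 0 then
      if 0 ≤ x ∧ 0 < y then (1, 0) else if 0 < x then (0, -1) else if y < 0 then (-1, 0)
      else (0, 1)
    else
      if 0 < x ∧ 0 < y then (-1, 0) else if 0 < x then (0, 1) else if y < 0 then (1, 0)
      else (0, -1)
  else
    if (x + y) % 2 = 0 then
      if 0 < x ∧ 0 ≤ y then (0, 1) else if 0 ≤ x ∧ y < 0 then (1, 0) else if y ≤ 0 then (0, -1)
      else (-1, 0)
    else
      if 0 < x ∧ 0 < y then (0, -1) else if 0 < x then (-1, 0) else if y < 0 then (0, 1)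
      else (1, 0)

theorem ringStep_unit (z x y : ℤ) : ringStep z x y = (1, 0) ∨ ringStep z x y = (-1, 0) ∨
    ringStep z x y = (0, 1) ∨ ringStep z x y = (0, -1) := by
  unfold ringStep
  split_ifs <;> simp

/-- For even `s` the outermost ring, at distances `s - 2` and `s - 1`, is complete. -/
theorem InRing.ringStep_add {s x y : ℤ} (hs : s % 2 = 0) (h : InRing s x y) (z : ℤ) :
    InRing s (x + (ringStep z x y).1) (y + (ringStep z x y).2) := by
  unfold InRing ringStep at *
  split_ifs <;> simp only <;> omega

theorem InRing.ringStep_ringStep {s x y : ℤ} (h : InRing s x y) (z : ℤ) :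
    ringStep z (x + (ringStep z x y).1) (y + (ringStep z x y).2) = -ringStep z x y := by
  have key : ∀ a b, ringStep z x y = (a, b) → ringStep z (x + a) (y + b) = (-a, -b) := by
    intro a b hab
    unfold InRing at h
    unfold ringStep at hab ⊢
    split_ifs at hab <;> simp only [Prod.mk.injEq] at hab <;> obtain ⟨rfl, rfl⟩ := hab <;>
      split_ifs <;> first | rfl | (exfalso; omega)
  exact key _ _ rfl

/-- The two floors step to the two different neighbours in the ring. These lie in perpendicular
directions off the axes and in opposite directions on them. -/
theorem InRing.det_ringStep {s x y : ℤ} (h : InRing s x y) :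
    (ringStep 0 x y).1 * (ringStep 1 x y).2 - (ringStep 0 x y).2 * (ringStep 1 x y).1
      = if x ≠ 0 ∧ y ≠ 0 then 1 else 0 := by
  unfold InRing at h
  simp only [ringStep]
  split_ifs <;> omega

/-! ### Tilings from a packing of diamonds. -/

/-- The centres are so far from each other, and from the boundary of the box, that the diamonds
`|x| + |y| < s` around them are disjoint and contained in the box. -/
structure IsPacking (L M : ℕ) (s : ℤ) (C : Finset (ℤ × ℤ)) : Prop where
  disjoint : ∀ a ∈ C, ∀ b ∈ C, ∀ x y, InRing s (x - a.1) (y - a.2) → InRing s (x - b.1) (y - b.2) →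
    a = b
  mem : ∀ a ∈ C, ∀ x y, InRing s (x - a.1) (y - a.2) → (x, y) ∈ columns L M

open Classical in
/-- The displacement along the rings around the points of `C`. -/
noncomputable def packingStep (s : ℤ) (C : Finset (ℤ × ℤ)) (z x y : ℤ) : ℤ × ℤ :=
  if h : ∃ a ∈ C, InRing s (x - a.1) (y - a.2) then ringStep z (x - h.choose.1) (y - h.choose.2)
  else 0

namespace IsPacking

variable {L M : ℕ} {s : ℤ} {C : Finset (ℤ × ℤ)}

theorem packingStep_eq (h : IsPacking L M s C) {a : ℤ × ℤ} (ha : a ∈ C) {x y : ℤ}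
    (hxy : InRing s (x - a.1) (y - a.2)) (z : ℤ) :
    packingStep s C z x y = ringStep z (x - a.1) (y - a.2) := by
  have hex : ∃ a ∈ C, InRing s (x - a.1) (y - a.2) := ⟨a, ha, hxy⟩
  rw [packingStep, dif_pos hex,
    h.disjoint _ hex.choose_spec.1 a ha x y hex.choose_spec.2 hxy]

theorem isDuplexPlan (h : IsPacking L M s C) (hs : s % 2 = 0) :
    IsDuplexPlan L M (packingStep s C) := by
  have hcase : ∀ x y, (∃ a ∈ C, InRing s (x - a.1) (y - a.2)) ∨ ∀ z, packingStep s C z x y = 0 := by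
    intro x y
    by_cases hex : ∃ a ∈ C, InRing s (x - a.1) (y - a.2)
    · exact .inl hex
    · exact .inr fun z => dif_neg hex
  have hshift : ∀ a ∈ C, ∀ z x y, InRing s (x - a.1) (y - a.2) →
      InRing s (x + (ringStep z (x - a.1) (y - a.2)).1 - a.1)
        (y + (ringStep z (x - a.1) (y - a.2)).2 - a.2) := by
    intro a _ z x y hxy
    rw [add_sub_right_comm, add_sub_right_comm]
    exact hxy.ringStep_add hs z
  refine ⟨fun z x y => ?_, fun z x y hc => ?_, fun z x y => ?_, fun x y => ?_⟩
  · rcases hcase x y with ⟨a, ha, hxy⟩ | h0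
    · rw [h.packingStep_eq ha hxy]
      exact .inr (ringStep_unit _ _ _)
    · exact .inl (h0 z)
  · rcases hcase x y with ⟨a, ha, hxy⟩ | h0
    · rw [h.packingStep_eq ha hxy]
      exact h.mem a ha _ _ (hshift a ha z x y hxy)
    · simpa [h0 z] using hc
  · rcases hcase x y with ⟨a, ha, hxy⟩ | h0
    · rw [h.packingStep_eq ha hxy, h.packingStep_eq ha (hshift a ha z x y hxy),
        add_sub_right_comm, add_sub_right_comm]
      exact hxy.ringStep_ringStep z
    · simp [h0 z]
  · rcases hcase x y with ⟨a, ha, hxy⟩ | h0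
    · have hne : ∀ z, packingStep s C z x y ≠ 0 := by
        intro z
        rw [h.packingStep_eq ha hxy]
        rcases ringStep_unit z (x - a.1) (y - a.2) with e | e | e | e <;> simp [e]
      exact iff_of_false (hne 0) (hne 1)
    · simp [h0]

theorem columnTwist_nonneg (h : IsPacking L M s C) (c : ℤ × ℤ) :
    0 ≤ columnTwist (packingStep s C) c := by
  by_cases hex : ∃ a ∈ C, InRing s (c.1 - a.1) (c.2 - a.2)
  · obtain ⟨a, ha, hc⟩ := hex
    rw [columnTwist, h.packingStep_eq ha hc, h.packingStep_eq ha hc, hc.det_ringStep]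
    split_ifs <;> norm_num
  · rw [columnTwist, packingStep, dif_neg hex]
    simp

theorem le_twist (h : IsPacking L M s C) (hs : s % 2 = 0) {G : Finset (ℤ × ℤ)}
    (hG : ∀ b ∈ G, InRing s b.1 b.2 ∧ b.1 ≠ 0 ∧ b.2 ≠ 0) :
    (C.card * G.card : ℝ) / 4 ≤ twist (planTiling L M (packingStep s C)) := by
  rw [(h.isDuplexPlan hs).twist_eq]
  have hin : ∀ p ∈ C ×ˢ G, InRing s ((p.1 + p.2).1 - p.1.1) ((p.1 + p.2).2 - p.1.2) := by
    intro p hp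
    simpa using (hG _ (Finset.mem_product.1 hp).2).1
  -- The diamonds are disjoint, so a column determines its centre and its position relative to it.
  have hinj : Set.InjOn (fun p : (ℤ × ℤ) × (ℤ × ℤ) => p.1 + p.2) (C ×ˢ G : Finset _) := by
    intro p hp q hq e
    simp only at e
    have h1 : p.1 = q.1 := h.disjoint _ (Finset.mem_product.1 hp).1 _ (Finset.mem_product.1 hq).1
      _ _ (hin p hp) (by rw [e]; exact hin q hq)
    rw [h1] at e
    exact Prod.ext h1 (add_left_cancel e)
  calc (C.card * G.card : ℝ) / 4 = ∑ p ∈ C ×ˢ G, columnTwist (packingStep s C) (p.1 + p.2) := by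
        have : ∀ p ∈ C ×ˢ G, columnTwist (packingStep s C) (p.1 + p.2) = 1 / 4 := by
          intro p hp
          have hC := (Finset.mem_product.1 hp).1
          rw [columnTwist, h.packingStep_eq hC (hin p hp), h.packingStep_eq hC (hin p hp),
            (hin p hp).det_ringStep, if_pos (by simpa using (hG _ (Finset.mem_product.1 hp).2).2)]
          norm_num
        rw [Finset.sum_congr rfl this, Finset.sum_const, Finset.card_product]
        simp
        ring
    _ = ∑ c ∈ (C ×ˢ G).image (fun p => p.1 + p.2), columnTwist (packingStep s C) c :=
        (Finset.sum_image hinj).symm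
    _ ≤ _ := by
        refine Finset.sum_le_sum_of_subset_of_nonneg ?_ fun c _ _ => h.columnTwist_nonneg c
        intro c hc
        obtain ⟨p, hp, rfl⟩ := Finset.mem_image.1 hc
        exact h.mem _ (Finset.mem_product.1 hp).1 _ _ (hin p hp)

end IsPacking

/-! ### Counting columns and placing the centres. -/

/-- Points of the diamond off the axes, given by their distances from the axes and signs. -/
def offAxis (s : ℕ) : Finset (ℤ × ℤ) :=
  (((Finset.range (s - 1)).sigma fun k => Finset.range k) ×ˢ
    (({1, -1} : Finset ℤ) ×ˢ ({1, -1} : Finset ℤ))).image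
    fun p => (p.2.1 * ((p.1.2 : ℤ) + 1), p.2.2 * ((p.1.1 : ℤ) - p.1.2))

theorem card_offAxis (s : ℕ) : (offAxis s).card = 2 * ((s - 1) * (s - 1 - 1)) := by
  rw [offAxis, Finset.card_image_of_injOn]
  · rw [Finset.card_product, Finset.card_sigma]
    simp only [Finset.card_range, Finset.card_product]
    have := Finset.sum_range_id_mul_two (s - 1)
    rw [← this]
    simp
    ring
  · rintro ⟨⟨k, j⟩, e, f⟩ hp ⟨⟨k', j'⟩, e', f'⟩ hq h
    simp only [Finset.coe_product, Set.mem_prod, Finset.mem_coe, Finset.mem_sigma,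
      Finset.mem_range, Finset.mem_insert, Finset.mem_singleton] at hp hq
    simp only [Prod.mk.injEq] at h
    obtain ⟨⟨_, hj⟩, he, hf⟩ := hp
    obtain ⟨⟨_, hj'⟩, he', hf'⟩ := hq
    obtain ⟨h1, h2⟩ := h
    -- Both `j + 1` and `k - j` are positive, so the signs and absolute values of the coordinates
    -- determine all parameters.
    have : k = k' ∧ j = j' ∧ e = e' ∧ f = f' := by
      rcases he with rfl | rfl <;> rcases hf with rfl | rfl <;> rcases he' with rfl | rfl <;>
        rcases hf' with rfl | rfl <;> refine ⟨?_, ?_, ?_, ?_⟩ <;> omega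
    obtain ⟨rfl, rfl, rfl, rfl⟩ := this
    rfl

theorem inRing_of_mem_offAxis {s : ℕ} {b : ℤ × ℤ} (hb : b ∈ offAxis s) :
    InRing s b.1 b.2 ∧ b.1 ≠ 0 ∧ b.2 ≠ 0 := by
  obtain ⟨⟨⟨k, j⟩, e, f⟩, hp, rfl⟩ := Finset.mem_image.1 hb
  simp only [Finset.mem_product, Finset.mem_sigma, Finset.mem_range, Finset.mem_insert,
    Finset.mem_singleton] at hp
  obtain ⟨⟨hk, hj⟩, he, hf⟩ := hp
  unfold InRing
  rcases he with rfl | rfl <;> rcases hf with rfl | rfl <;> simp only <;> omega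

/-- The points of `s ℤ²` with even coordinate sum, up to the scaling. -/
def centres (s P Q : ℕ) : Finset (ℤ × ℤ) :=
  (Finset.range P ×ˢ Finset.range Q ×ˢ Finset.range 2).image
    fun p => ((s : ℤ) * (2 * p.1 + 1 + p.2.2), (s : ℤ) * (2 * p.2.1 + 1 + p.2.2))

theorem card_centres {s : ℕ} (hs : 0 < s) (P Q : ℕ) : (centres s P Q).card = 2 * (P * Q) := by
  rw [centres, Finset.card_image_of_injOn]
  · simp; ring
  · rintro ⟨p, q, e⟩ hp ⟨p', q', e'⟩ hq h
    simp at hp hq h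
    simp only [Prod.mk.injEq]
    omega

theorem isPacking_centres {s P Q L M : ℕ} (hL : s * (2 * P + 1) ≤ L) (hM : s * (2 * Q + 1) ≤ M) :
    IsPacking L M s (centres s P Q) := by
  constructor
  · intro a ha b hb x y h1 h2
    obtain ⟨⟨p, q, e⟩, hp, rfl⟩ := Finset.mem_image.1 ha
    obtain ⟨⟨p', q', e'⟩, hp', rfl⟩ := Finset.mem_image.1 hb
    have k1 := h1.1
    have k2 := h2.1
    simp only at k1 k2
    have hs : (0 : ℤ) < s := by omega
    set i : ℤ := 2 * p + 1 + e with hi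
    set j : ℤ := 2 * q + 1 + e with hj
    set i' : ℤ := 2 * p' + 1 + e' with hi'
    set j' : ℤ := 2 * q' + 1 + e' with hj'
    -- A common point makes the ℓ¹ distance of the index pairs less than 2. It is even, since `i`
    -- and `j` have the same parity, as have `i'` and `j'`; so it is 0.
    have lt : ∀ n : ℤ, s * n < s * 2 → n < 2 := fun n h => lt_of_mul_lt_mul_left h hs.le
    have l1 := lt (i - i' + (j - j')) (by linarith)
    have l2 := lt (i - i' - (j - j')) (by linarith)
    have l3 := lt (-(i - i') + (j - j')) (by linarith)
    have l4 := lt (-(i - i') - (j - j')) (by linarith)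
    have e1 : i = i' := by omega
    have e2 : j = j' := by omega
    simp only [e1, e2]
  · intro a ha x y h
    obtain ⟨⟨p, q, e⟩, hp, rfl⟩ := Finset.mem_image.1 ha
    simp only [Finset.mem_product, Finset.mem_range] at hp
    have k := h.1
    simp only at k
    have hs : (0 : ℤ) < s := by omega
    have hp1 : (p : ℤ) + 1 ≤ P := by exact_mod_cast hp.1
    have hq1 : (q : ℤ) + 1 ≤ Q := by exact_mod_cast hp.2.1
    have he : (e : ℤ) ≤ 1 := by have := hp.2.2; omega
    have hL' : (s : ℤ) * (2 * P + 1) ≤ L := by exact_mod_cast hL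
    have hM' : (s : ℤ) * (2 * Q + 1) ≤ M := by exact_mod_cast hM
    have a1 : (s : ℤ) * (2 * p + 1 + e) ≤ s * (2 * P + 1) - s := by nlinarith
    have a2 : (s : ℤ) * (2 * q + 1 + e) ≤ s * (2 * Q + 1) - s := by nlinarith
    have b1 : (s : ℤ) ≤ s * (2 * p + 1 + e) := by nlinarith
    have b2 : (s : ℤ) ≤ s * (2 * q + 1 + e) := by nlinarith
    rw [mem_columns]
    simp only
    omega

theorem le_maxTwist {s P Q L M : ℕ} (hs : 2 ≤ s) (hs' : Even s) (hL : s * (2 * P + 1) ≤ L)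
    (hM : s * (2 * Q + 1) ≤ M) : (P * Q * ((s - 1) * (s - 2)) : ℝ) ≤ maxTwist L M 2 := by
  have h := isPacking_centres hL hM
  have hs2 : (s : ℤ) % 2 = 0 := by
    rw [Nat.even_iff] at hs'; omega
  refine le_trans ?_ ((isGreatest_maxTwist_two L M).2 ⟨_, (h.isDuplexPlan hs2).isTiling, rfl⟩)
  refine le_trans (le_of_eq ?_) (h.le_twist hs2 fun b hb => inRing_of_mem_offAxis hb)
  obtain ⟨r, rfl⟩ := Nat.exists_eq_add_of_le hs
  rw [card_offAxis, card_centres (by omega), show 2 + r - 1 - 1 = r by omega,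
    show 2 + r - 1 = 1 + r by omega]
  push_cast
  ring

theorem maxTwist_le (L M : ℕ) : maxTwist L M 2 ≤ L * M / 4 := by
  obtain ⟨t, ht, e⟩ := (isGreatest_maxTwist_two L M).1
  rw [← e]
  exact ht.twist_le

theorem le_maxTwist_of_le {s L M : ℕ} (hs : 2 ≤ s) (hs' : Even s) (hL : 3 * s ≤ L)
    (hM : 3 * s ≤ M) :
    ((L - 3 * s) * (M - 3 * s) * ((s - 1) * (s - 2)) / (4 * s ^ 2) : ℝ) ≤ maxTwist L M 2 := by
  have key : ∀ N : ℕ, 3 * s ≤ N → ∃ P : ℕ, s * (2 * P + 1) ≤ N ∧ (N - 3 * s : ℝ) ≤ 2 * s * P := by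
    intro N hN
    -- This is the largest `P` with `s * (2 * P + 1) ≤ N`.
    refine ⟨(N - s) / (2 * s), ?_, ?_⟩
    · have := Nat.mul_div_le (N - s) (2 * s)
      have e : s * (2 * ((N - s) / (2 * s)) + 1) = 2 * s * ((N - s) / (2 * s)) + s := by ring
      omega
    · have := Nat.lt_mul_div_succ (N - s) (show 0 < 2 * s by omega)
      have e : N < 2 * s * ((N - s) / (2 * s)) + 3 * s := by
        rw [mul_add] at this; omega
      have : (N : ℝ) < 2 * s * ((N - s) / (2 * s) : ℕ) + 3 * s := by exact_mod_cast e
      linarith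
  obtain ⟨P, hP, hP'⟩ := key L hL
  obtain ⟨Q, hQ, hQ'⟩ := key M hM
  refine le_trans ?_ (le_maxTwist hs hs' hP hQ)
  have hs2 : (2 : ℝ) ≤ s := by exact_mod_cast hs
  have hM2 : (3 * s : ℝ) ≤ M := by exact_mod_cast hM
  have h1 : (L - 3 * s : ℝ) * (M - 3 * s) ≤ 2 * s * P * (2 * s * Q) :=
    mul_le_mul hP' hQ' (by linarith) (by positivity)
  have h2 : (0 : ℝ) ≤ (s - 1) * (s - 2) := mul_nonneg (by linarith) (by linarith)
  rw [div_le_iff₀ (by positivity)]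
  calc _ ≤ 2 * s * P * (2 * s * Q) * (((s : ℝ) - 1) * (s - 2)) :=
        mul_le_mul_of_nonneg_right h1 h2
    _ = _ := by ring

end DominoTwist

/-! ### The limit. -/

open Filter Topology in
theorem mainTheorem9 :
    Filter.Tendsto
      (fun p : ℕ × ℕ => DominoTwist.maxTwist p.1 p.2 2 / (4 * (p.1 : ℝ) * (p.2 : ℝ)))
      (Filter.atTop ×ˢ Filter.atTop) (nhds (1 / 16)) := by
  rw [tendsto_order]
  have hpos : ∀ᶠ p : ℕ × ℕ in atTop ×ˢ atTop, 0 < p.1 ∧ 0 < p.2 :=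
    (eventually_gt_atTop 0).prod_mk (eventually_gt_atTop 0)
  constructor
  · intro a ha
    have hinv : ∀ c : ℝ, Tendsto (fun n : ℕ => 1 - c / (n : ℝ)) atTop (𝓝 1) := fun c => by
      simpa using (tendsto_const_nhds (x := (1 : ℝ))).sub (tendsto_const_div_atTop_nhds_zero_nat c)
    have hlim : Tendsto (fun s : ℕ => 1 / 16 * ((1 - 1 / (s : ℝ)) * (1 - 2 / (s : ℝ)))) atTop
        (𝓝 (1 / 16)) := by
      simpa only [mul_one] using ((hinv 1).mul (hinv 2)).const_mul (1 / 16)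
    -- The factor `(1 - 1 / s) * (1 - 2 / s)` is the share of off-axis columns, `2 * (s - 1) * (s -
    -- 2)` out of the area `2 * s ^ 2` of a diamond. The radius is fixed before the box grows.
    obtain ⟨s, hsa, hs2, hse⟩ : ∃ s : ℕ, a < 1 / 16 * ((1 - 1 / (s : ℝ)) * (1 - 2 / (s : ℝ))) ∧
        2 ≤ s ∧ Even s := by
      obtain ⟨N, hN⟩ := eventually_atTop.1 (hlim.eventually (lt_mem_nhds ha))
      exact ⟨2 * (N + 1), hN _ (by omega), by omega, even_two_mul _⟩
    have hlim2 : Tendsto (fun p : ℕ × ℕ => 1 / 16 * ((1 - 1 / (s : ℝ)) * (1 - 2 / (s : ℝ))) *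
        ((1 - 3 * s / (p.1 : ℝ)) * (1 - 3 * s / (p.2 : ℝ)))) (atTop ×ˢ atTop)
        (𝓝 (1 / 16 * ((1 - 1 / (s : ℝ)) * (1 - 2 / (s : ℝ))))) := by
      simpa using (((hinv (3 * s)).comp tendsto_fst).mul
        ((hinv (3 * s)).comp tendsto_snd)).const_mul
          (1 / 16 * ((1 - 1 / (s : ℝ)) * (1 - 2 / (s : ℝ))))
    filter_upwards [hlim2.eventually (lt_mem_nhds hsa), hpos,
      (eventually_ge_atTop (3 * s)).prod_mk (eventually_ge_atTop (3 * s))] with p hp h0 hge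
    refine hp.trans_le ?_
    have h1 : (0 : ℝ) < p.1 := by exact_mod_cast h0.1
    have h2 : (0 : ℝ) < p.2 := by exact_mod_cast h0.2
    have h3 : (0 : ℝ) < s := by exact_mod_cast (by omega : 0 < s)
    rw [le_div_iff₀ (by positivity)]
    refine le_trans (le_of_eq ?_) (DominoTwist.le_maxTwist_of_le hs2 hse hge.1 hge.2)
    field_simp
    ring
  · intro a ha
    filter_upwards [hpos] with p h0
    refine lt_of_le_of_lt ?_ ha
    have h1 : (0 : ℝ) < p.1 := by exact_mod_cast h0.1
    have h2 : (0 : ℝ) < p.2 := by exact_mod_cast h0.2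
    rw [div_le_iff₀ (by positivity)]
    linarith [DominoTwist.maxTwist_le p.1 p.2]
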